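/- For an integer $n\ge 1$ let $\mathcal F_n=\frac1{\sqrt n}\bigl(e^{2\pi i jk/n}\bigr)_{0\le j,k\le n-1}$ be the Fourier matrix. For a unit $m$ of $\mathbb Z_n=\mathbb Z/n\mathbb Z$ let $P_{(\cdot m)}$ be the permutation matrix with $P_{(\cdot m)}[j,k]=1$ if $j\equiv mk \pmod n$ and $0$ otherwise. Let $m\neq 1$ be a unit of $\mathbb Z_n$, represented by a positive integer which is also denoted by $m$ (any such representative may be used). Let $M=\mathcal F_nP_{(\cdot m)}$, and let $t_\lambda$ be the multiplicity of $\lambda$ as an eigenvalue of $M$ (algebraic and geometric multiplicities coincide; $t_\lambda=0$ means that $\lambda$ is not an eigenvalue). Then the trace of $M$ and the multiplicities of $1,-1,i,-i$ are given by the following table, in which $k$ and $l$ are non-negative integers, $\left(\frac{a}{b}\right)$ is the Jacobi symbol, and an empty entry means no condition: $$ \begin{array}{|l|l|l|r|r|r|r|r|} \hline n & m & \text{Jacobi symbol} & \operatorname{tr}(M) & t_1 & t_{-1} & t_i & t_{-i}\\ \hline 4k & 4l+1 & \left(\frac nm\right)=1 & 1+i & k+1 & k & k & k-1\\ \hline 4k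 & 4l+1 & \left(\frac nm\right)=-1 & -1-i & k & k+1 & k-1 & k\\ \hline 4k & 4l+3 & \left(\frac nm\right)=1 & 1-i & k+1 & k & k-1 & k\\ \hline 4k & 4l+3 & \left(\frac nm\right)=-1 & -1+i & k & k+1 & k & k-1\\ \hline 4k+1 & & \left(\frac mn\right)=1 & 1 & k+1 & k & k & k\\ \hline 4k+1 & & \left(\frac mn\right)=-1 & -1 & k & k+1 & k & k\\ \hline 4k+2 & & & 0 & k+1 & k+1 & k & k\\ \hline 4k+3 & & \left(\frac mn\right)=1 & i & k+1 & k+1 & k+1 & k\\ \hline 4k+3 & & \left(\frac mn\right)=-1 & -i & k+1 & k+1 & k & k+1\\ \hline \end{array} $$ -/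

import Mathlib

/-- The Fourier matrix of `ℤ/nℤ`: `F[j,k] = n^{-1/2} exp(2π i j k / n)`, rows and columns indexed by
`0, …, n - 1`. -/
noncomputable def fourierMatrix (n : ℕ) : Matrix (ZMod n) (ZMod n) ℂ :=
  Matrix.of fun j k =>
    (1 / (Real.sqrt n : ℂ)) *
      Complex.exp (2 * (Real.pi : ℂ) * Complex.I * (j.val : ℂ) * (k.val : ℂ) / (n : ℂ))

/-- The permutation matrix `P_σ`, with `P_σ[j,k] = 1` if `j = σ k` and `0` otherwise. -/
def permutationMatrix {n : ℕ} (σ : Equiv.Perm (ZMod n)) : Matrix (ZMod n) (ZMod n) ℂ :=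
  Matrix.of fun j k => if j = σ k then 1 else 0

/-- The permutation `k ↦ m k` of `ℤ/nℤ`, for a unit `m`. -/
def mulPerm {n : ℕ} (m : (ZMod n)ˣ) : Equiv.Perm (ZMod n) :=
  Units.mulLeft m

/-- The matrix `F_n P_{(· m)}`. -/
noncomputable def permutedFourierMatrix (n : ℕ) [NeZero n] (m : (ZMod n)ˣ) :
    Matrix (ZMod n) (ZMod n) ℂ :=
  fourierMatrix n * permutationMatrix (mulPerm m)

/-- `μ` has multiplicity `t` as an eigenvalue of `M` (with `t = 0` if it is not an eigenvalue), both
algebraically (as a root of the characteristic polynomial) and geometrically (as the dimension of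
the eigenspace). -/
def HasEigenvalueMultiplicity {n : ℕ} [NeZero n] (M : Matrix (ZMod n) (ZMod n) ℂ) (μ : ℂ) (t : ℤ) :
    Prop :=
  (M.charpoly.rootMultiplicity μ : ℤ) = t ∧
    (Module.finrank ℂ (Module.End.eigenspace (Matrix.toLin' M) μ) : ℤ) = t

/-- A row of the table: the trace of `M` is `τ` and the eigenvalues `1, -1, i, -i` of `M` have
multiplicities `a, b, c, d`, respectively. -/
def HasTraceAndMultiplicities {n : ℕ} [NeZero n] (M : Matrix (ZMod n) (ZMod n) ℂ) (τ : ℂ)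
    (a b c d : ℤ) : Prop :=
  M.trace = τ ∧
    HasEigenvalueMultiplicity M 1 a ∧
    HasEigenvalueMultiplicity M (-1) b ∧
    HasEigenvalueMultiplicity M Complex.I c ∧
    HasEigenvalueMultiplicity M (-Complex.I) d

/-! The entries of `M` are `n^{-1/2} e(mjk/n)`, where `e(x) = exp(2πi x)`. Orthogonality of
characters makes `M ^ 2` the permutation matrix of `j ↦ -j`, so `M ^ 4 = 1`. Hence `M` is
diagonalizable with eigenvalues among the fourth roots of unity, and the multiplicity of `μ` is the
trace of the projection `(1/4) ∑ μ^{-j} M ^ j` over `j < 4`. Here `tr 1 = n`, `tr M ^ 2` counts the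
solutions of `j = -j`, and `tr M ^ 3` is the conjugate of `tr M`. So everything reduces to `tr M =
G(m, n) / √n`, where `G(a, n) = ∑ e(a j² / n)` is `quadGauss`.

The sign of the Gauss sum comes from analysis: `quadGauss_one_left` evaluates `G(1, N)` by letting
the argument of the theta functional equation tend to `-2i/N` (the Landsberg–Schaar method). The
dependence on `a` is arithmetic. For odd `n`, `quadGauss_odd` gives `G(a, n) = (a/n) G(1, n)`. For
even `n` the unit `m` is odd, and the Chinese remainder theorem applied to `n m` gives `G(m, n)
(n/m) G(1, m) = G(1, n m)`, which determines `G(m, n)` from known values. Quadratic reciprocity is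
never needed. -/

/-! ### Arithmetic of quadratic Gauss sums -/

/-- The additive character `t ↦ exp (2πi t / n)` on the natural numbers. -/
noncomputable def rootExp (n t : ℕ) : ℂ :=
  Complex.exp (2 * Real.pi * Complex.I * t / n)

/-- The quadratic Gauss sum `∑_{j mod n} exp (2πi a j² / n)`. -/
noncomputable def quadGauss (a n : ℕ) : ℂ :=
  ∑ j : Fin n, rootExp n (a * (j : ℕ) ^ 2)

theorem rootExp_add (n s t : ℕ) : rootExp n (s + t) = rootExp n s * rootExp n t := by
  rw [rootExp, rootExp, rootExp, ← Complex.exp_add]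
  push_cast
  congr 1
  ring

theorem rootExp_mul_cancel (b : ℕ) {c : ℕ} (hc : c ≠ 0) (t : ℕ) :
    rootExp (b * c) (c * t) = rootExp b t := by
  have : (c : ℂ) ≠ 0 := by exact_mod_cast hc
  rw [rootExp, rootExp]
  push_cast
  congr 1
  rw [mul_comm (b : ℂ) c, show 2 * (Real.pi : ℂ) * Complex.I * (c * t) =
    c * (2 * Real.pi * Complex.I * t) by ring, mul_div_mul_left _ _ this]

theorem rootExp_eq_stdAddChar (n : ℕ) [NeZero n] (t : ℕ) :
    rootExp n t = ZMod.stdAddChar (t : ZMod n) := by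
  have := ZMod.stdAddChar_coe (N := n) (t : ℤ)
  push_cast at this
  rw [this, rootExp]

theorem rootExp_mul_self (n : ℕ) [NeZero n] (t : ℕ) : rootExp n (n * t) = 1 := by
  rw [rootExp_eq_stdAddChar]
  simp

theorem ZMod.bijective_natCast_fin (n : ℕ) [NeZero n] :
    Function.Bijective (fun j : Fin n => ((j : ℕ) : ZMod n)) := by
  rw [Fintype.bijective_iff_injective_and_card]
  refine ⟨fun x y h => ?_, by simp⟩
  have h' := (ZMod.natCast_eq_natCast_iff' _ _ _).1 h
  rw [Nat.mod_eq_of_lt x.2, Nat.mod_eq_of_lt y.2] at h'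
  exact Fin.ext h'

theorem quadGauss_eq_sum_zmod (a n : ℕ) [NeZero n] :
    quadGauss a n = ∑ x : ZMod n, ZMod.stdAddChar ((a : ZMod n) * x ^ 2) := by
  refine Fintype.sum_bijective _ (ZMod.bijective_natCast_fin n) _ _ fun x => ?_
  rw [rootExp_eq_stdAddChar]
  push_cast
  rfl

theorem quadGauss_one_right (a : ℕ) : quadGauss a 1 = 1 := by
  simp [quadGauss, rootExp]

/-- By the Chinese remainder theorem, `c x + b y` runs over the residues mod `b c`. The cross term
of its square is a multiple of `b c`, so the exponential factors. -/
theorem quadGauss_mul (a : ℕ) {b c : ℕ} (hb : b ≠ 0) (hc : c ≠ 0) (h : b.Coprime c) :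
    quadGauss a (b * c) = quadGauss (a * c) b * quadGauss (a * b) c := by
  have : NeZero b := ⟨hb⟩
  have : NeZero c := ⟨hc⟩
  rw [quadGauss_eq_sum_zmod, quadGauss, quadGauss, Fintype.sum_mul_sum, ← Fintype.sum_prod_type']
  symm
  refine Fintype.sum_bijective
    (fun p : Fin b × Fin c => ((c * (p.1 : ℕ) + b * (p.2 : ℕ) : ℕ) : ZMod (b * c))) ?_ _ _ ?_
  · rw [Fintype.bijective_iff_injective_and_card]
    refine ⟨?_, by simp [ZMod.card]⟩
    rintro ⟨x, y⟩ ⟨x', y'⟩ hxy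
    have hxy' := (ZMod.natCast_eq_natCast_iff _ _ _).1 hxy
    have h1 : c * (x : ℕ) ≡ c * x' [MOD b] := by
      have := hxy'.of_mul_right c
      simpa [Nat.ModEq] using this
    have h2 : b * (y : ℕ) ≡ b * y' [MOD c] := by
      have := hxy'.of_mul_left b
      simpa [Nat.ModEq] using this
    have h1' := Nat.ModEq.cancel_left_of_coprime h h1
    have h2' := Nat.ModEq.cancel_left_of_coprime h.symm h2
    rw [Nat.ModEq, Nat.mod_eq_of_lt x.2, Nat.mod_eq_of_lt x'.2] at h1'
    rw [Nat.ModEq, Nat.mod_eq_of_lt y.2, Nat.mod_eq_of_lt y'.2] at h2'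
    exact Prod.ext (Fin.ext h1') (Fin.ext h2')
  · rintro ⟨x, y⟩
    have : ((a : ZMod (b * c)) * ((c * (x : ℕ) + b * (y : ℕ) : ℕ) : ZMod (b * c)) ^ 2) =
        ((c * (a * c * (x : ℕ) ^ 2) + b * (a * b * (y : ℕ) ^ 2) +
          b * c * (2 * a * x * y) : ℕ) : ZMod (b * c)) := by
      push_cast
      ring
    simp only
    rw [this, ← rootExp_eq_stdAddChar, rootExp_add, rootExp_add, rootExp_mul_self,
      rootExp_mul_cancel b hc, mul_one, mul_comm b c, rootExp_mul_cancel c hb]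

theorem sum_rootExp_mul (p s : ℕ) [NeZero p] :
    ∑ v : Fin p, rootExp p (s * v) = if p ∣ s then (p : ℂ) else 0 := by
  have h1 : ∑ v : Fin p, rootExp p (s * v) =
      ∑ x : ZMod p, ZMod.stdAddChar (x * (s : ZMod p)) := by
    refine Fintype.sum_bijective _ (ZMod.bijective_natCast_fin p) _ _ fun x => ?_
    rw [rootExp_eq_stdAddChar, mul_comm]
    push_cast
    rfl
  rw [h1, AddChar.sum_mulShift _ (ZMod.isPrimitive_stdAddChar p), ZMod.card]
  simp [ZMod.natCast_eq_zero_iff]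

/-- Write the index as `u + p q v` with `u < p q` and `v < p`. Modulo `p² q` the square is linear in
`v`, so the sum over `v` is a full character sum of frequency `2 a u` mod `p`. It vanishes unless `p
∣ u`, and the surviving `u = p x` give `G(a, q)`. -/
theorem quadGauss_sq_mul {a p q : ℕ} (hp : p ≠ 0) (hq : q ≠ 0) (ha : (2 * a).Coprime p) :
    quadGauss a (p * (p * q)) = p * quadGauss a q := by
  have : NeZero p := ⟨hp⟩
  have hpq : p * q ≠ 0 := mul_ne_zero hp hq
  have key : ∀ (v : Fin p) (u : Fin (p * q)),
      rootExp (p * (p * q)) (a * (finProdFinEquiv (v, u) : ℕ) ^ 2) =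
        rootExp (p * (p * q)) (a * (u : ℕ) ^ 2) * rootExp p ((2 * a * u) * v) := by
    intro v u
    have hexp : a * (finProdFinEquiv (v, u) : ℕ) ^ 2 = a * (u : ℕ) ^ 2 +
        (p * q) * ((2 * a * u) * v) + (p * (p * q)) * (a * q * v ^ 2) := by
      simp only [finProdFinEquiv_apply_val]
      ring
    have : NeZero (p * (p * q)) := ⟨mul_ne_zero hp hpq⟩
    rw [hexp, rootExp_add, rootExp_add, rootExp_mul_self, mul_one, rootExp_mul_cancel p hpq]
  rw [quadGauss, ← finProdFinEquiv.sum_comp, Fintype.sum_prod_type_right]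
  simp_rw [key, ← Finset.mul_sum, sum_rootExp_mul]
  have hdvd : ∀ u : ℕ, p ∣ 2 * a * u ↔ p ∣ u := fun u =>
    ⟨fun h => ha.symm.dvd_of_dvd_mul_left h, fun h => h.mul_left _⟩
  simp_rw [hdvd]
  -- Reindex `u = y + p x` with `y < p` and `x < q`; then `p ∣ u` means `y = 0`.
  rw [← ((finProdFinEquiv (m := q) (n := p)).trans (finCongr (mul_comm q p))).sum_comp,
    Fintype.sum_prod_type, quadGauss, Finset.mul_sum]
  refine Finset.sum_congr rfl fun x _ => ?_
  have h2 : ∀ y : Fin p, (p ∣ ((((finProdFinEquiv (m := q) (n := p)).trans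
      (finCongr (mul_comm q p))) (x, y) : Fin (p * q)) : ℕ)) ↔ y = 0 := by
    intro y
    simp only [Equiv.trans_apply, finCongr_apply, Fin.val_cast, finProdFinEquiv_apply_val]
    rw [Nat.dvd_add_left (dvd_mul_right _ _)]
    constructor
    · intro h
      exact Fin.ext (by simpa using Nat.eq_zero_of_dvd_of_lt h y.2)
    · rintro rfl
      simp
  simp_rw [h2]
  rw [Finset.sum_eq_single 0]
  · simp only [Equiv.trans_apply, finCongr_apply, Fin.val_cast, finProdFinEquiv_apply_val, if_true,
      Fin.val_zero, zero_add]
    have : a * (p * (x : ℕ)) ^ 2 = (p * p) * (a * (x : ℕ) ^ 2) := by ring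
    rw [this, ← mul_assoc p p q, mul_comm (p * p) q, rootExp_mul_cancel q (mul_ne_zero hp hp),
      mul_comm]
  · intro y _ hy
    simp [hy]
  · simp

/-- An element `y` has `χ(y) + 1` square roots, `χ` being the quadratic character. Grouping the sum
by `y = x²`, the constant `1` contributes a vanishing character sum, which leaves the Gauss sum of
`χ`. Twisting its additive character by `a` brings out `χ(a)`. -/
theorem quadGauss_prime {p : ℕ} (hp : p.Prime) (hp2 : p ≠ 2) {a : ℕ} (ha : a.Coprime p) :
    quadGauss a p = jacobiSym a p * quadGauss 1 p := by
  have : Fact p.Prime := ⟨hp⟩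
  have hchar : ringChar (ZMod p) ≠ 2 := by rwa [ZMod.ringChar_zmod_n]
  set χ : MulChar (ZMod p) ℂ := (quadraticChar (ZMod p)).ringHomComp (Int.castRingHom ℂ) with hχ
  have key : ∀ b : ℕ, b.Coprime p → quadGauss b p =
      gaussSum χ ((ZMod.stdAddChar (N := p)).mulShift (b : ZMod p)) := by
    intro b hb
    have hb0 : (b : ZMod p) ≠ 0 := by
      rw [Ne, ZMod.natCast_eq_zero_iff]
      exact fun h => hp.one_lt.ne' (Nat.eq_one_of_dvd_coprimes hb h dvd_rfl)
    have hsum : ∑ y : ZMod p, (ZMod.stdAddChar ((b : ZMod p) * y) : ℂ) = 0 := by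
      simp_rw [mul_comm (b : ZMod p)]
      rw [AddChar.sum_mulShift _ (ZMod.isPrimitive_stdAddChar p), if_neg hb0, Nat.cast_zero]
    rw [quadGauss_eq_sum_zmod, gaussSum,
      ← Finset.sum_fiberwise (g := fun x : ZMod p => x ^ 2)]
    calc _ = ∑ y : ZMod p, ((quadraticChar (ZMod p) y + 1 : ℤ) : ℂ) *
          ZMod.stdAddChar ((b : ZMod p) * y) := by
          refine Finset.sum_congr rfl fun y _ => ?_
          rw [← quadraticChar_card_sqrts hchar y, Finset.sum_congr rfl
            (g := fun _ => (ZMod.stdAddChar ((b : ZMod p) * y) : ℂ))]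
          · rw [Finset.sum_const, nsmul_eq_mul]
            congr 2
            congr 1
            ext x
            simp
          · intro x hx
            rw [(Finset.mem_filter.1 hx).2]
      _ = _ := by
          push_cast
          simp_rw [add_mul, Finset.sum_add_distrib, one_mul, hsum, add_zero]
          rfl
  have hu : IsUnit (a : ZMod p) := (ZMod.isUnit_iff_coprime a p).2 ha
  have h1 := gaussSum_mulShift χ (ZMod.stdAddChar (N := p)) hu.unit
  rw [IsUnit.unit_spec, ← key a ha] at h1
  have h2 := key 1 (Nat.coprime_one_left p)
  rw [Nat.cast_one, AddChar.mulShift_one] at h2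
  have h3 : χ (a : ZMod p) = (jacobiSym a p : ℂ) := by
    rw [← jacobiSym.legendreSym.to_jacobiSym, legendreSym]
    simp [hχ, MulChar.ringHomComp_apply]
  have h4 : (jacobiSym a p : ℂ) ^ 2 = 1 := by
    exact_mod_cast jacobiSym.sq_one (by simpa using ha)
  rw [h2, ← h1, h3, ← mul_assoc, ← sq, h4, one_mul]

/-- Induction, splitting off a prime `p`. If `p² ∣ n`, remove `p²`, which contributes a square to
the Jacobi symbol. Otherwise split `n = p q` by coprimality; the symbols `(q/p)` and `(p/q)` then
occur for `a` and for `1` alike, so they match. -/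
theorem quadGauss_odd {n : ℕ} (hn : Odd n) {a : ℕ} (ha : a.Coprime n) :
    quadGauss a n = jacobiSym a n * quadGauss 1 n := by
  induction n using Nat.strong_induction_on generalizing a with
  | _ n ih =>
  by_cases hn1 : n = 1
  · subst hn1
    simp [quadGauss_one_right]
  obtain ⟨p, hp, q, rfl⟩ := Nat.exists_prime_and_dvd hn1
  have hp_odd : Odd p := Nat.Odd.of_mul_left hn
  have hq_odd : Odd q := Nat.Odd.of_mul_right hn
  have hp2 : p ≠ 2 := by
    rintro rfl
    exact absurd hp_odd (by decide)
  have hp0 := hp.ne_zero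
  have hq0 : q ≠ 0 := hq_odd.pos.ne'
  have hap : a.Coprime p := ha.coprime_mul_right_right
  have haq : a.Coprime q := ha.coprime_mul_left_right
  by_cases hpq : p ∣ q
  · obtain ⟨s, rfl⟩ := hpq
    have hs0 : s ≠ 0 := right_ne_zero_of_mul hq0
    have h2p : (2 : ℕ).Coprime p := Nat.coprime_two_left.2 hp_odd
    have hlt : s < p * (p * s) := by
      have := hp.two_le
      have hs : 0 < s := Nat.pos_of_ne_zero hs0
      nlinarith [Nat.mul_le_mul this this, Nat.mul_le_mul_right s (Nat.mul_le_mul this this)]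
    rw [quadGauss_sq_mul hp0 hs0 (h2p.mul_left hap), quadGauss_sq_mul hp0 hs0 (by simpa using h2p),
      ih s hlt (Nat.Odd.of_mul_right hq_odd) haq.coprime_mul_left_right,
      jacobiSym.mul_right' _ hp0 (mul_ne_zero hp0 hs0), jacobiSym.mul_right' _ hp0 hs0,
      ← mul_assoc (jacobiSym _ _), ← sq, jacobiSym.sq_one (by simpa using hap), one_mul]
    ring
  · have hcop : p.Coprime q := (Nat.Prime.coprime_iff_not_dvd hp).2 hpq
    have hlt : q < p * q := by
      have := hp.two_le
      have hs : 0 < q := Nat.pos_of_ne_zero hq0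
      nlinarith
    rw [quadGauss_mul a hp0 hq0 hcop, quadGauss_mul 1 hp0 hq0 hcop,
      quadGauss_prime hp hp2 (Nat.Coprime.mul_left hap hcop.symm),
      ih q hlt hq_odd (Nat.Coprime.mul_left haq hcop), one_mul, one_mul,
      quadGauss_prime hp hp2 hcop.symm, ih q hlt hq_odd hcop, jacobiSym.mul_right' _ hp0 hq0]
    push_cast
    rw [jacobiSym.mul_left, jacobiSym.mul_left]
    push_cast
    ring

/-! ### Evaluation of `G(1, N)` by the theta functional equation -/

open Filter Topology in
theorem tendsto_tsum_gaussian {ι : Type*} {l : Filter ι} [l.IsCountablyGenerated] {c : ι → ℂ}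
    (hc : Tendsto (fun i => (c i).re) l atTop) (x : ℝ) :
    Tendsto (fun i => ∑' n : ℤ, Complex.exp
      (-Real.pi * c i * n ^ 2 + 2 * Real.pi * (-Complex.I * x) * n)) l (𝓝 1) := by
  have hnorm : ∀ i (n : ℤ), ‖Complex.exp
      (-Real.pi * c i * n ^ 2 + 2 * Real.pi * (-Complex.I * x) * n)‖ =
      Real.exp (-Real.pi * (c i).re * (n : ℝ) ^ 2) := by
    intro i n
    rw [Complex.norm_exp]
    congr 1
    simp [pow_two]
  have hsum : Summable fun n : ℤ => Real.exp (-Real.pi * (n : ℝ) ^ 2) := by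
    simpa using summable_pow_mul_jacobiTheta₂_term_bound 0 one_pos 0
  -- Only the term `n = 0` survives. Since `x` is real the linear part is a pure phase, so `exp(-π
  -- n²)` dominates once `Re c ≥ 1`.
  have hlim := tendsto_tsum_of_dominated_convergence (𝓕 := l)
    (f := fun i (n : ℤ) => Complex.exp
      (-Real.pi * c i * n ^ 2 + 2 * Real.pi * (-Complex.I * x) * n))
    (g := fun n : ℤ => if n = 0 then (1 : ℂ) else 0) hsum ?_ ?_
  · rwa [tsum_ite_eq] at hlim
  · intro n
    by_cases hn : n = 0
    · simpa [hn] using tendsto_const_nhds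
    · rw [if_neg hn, tendsto_zero_iff_norm_tendsto_zero]
      simp_rw [hnorm]
      have hpos : 0 < Real.pi * (n : ℝ) ^ 2 := by positivity
      have := Real.tendsto_exp_neg_atTop_nhds_zero.comp (hc.const_mul_atTop hpos)
      refine this.congr fun i => ?_
      simp only [Function.comp_apply]
      congr 1
      ring
  · filter_upwards [hc.eventually_ge_atTop 1] with i hi n
    rw [hnorm, Real.exp_le_exp]
    nlinarith [mul_nonneg (mul_nonneg Real.pi_pos.le (sq_nonneg (n : ℝ))) (sub_nonneg.2 hi)]

/-- Poisson summation over the progression `k ℤ + s`. It isolates the factor `c ^ (1/2)` from a dual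
series tending to `1` as `Re c → ∞`. -/
theorem tsum_gaussian_progression {c : ℂ} (hc : 0 < c.re) {k : ℕ} (hk : k ≠ 0) (s : ℕ) :
    ∑' m : ℤ, Complex.exp (-Real.pi / (c * k ^ 2) * (m * k + s) ^ 2) =
      c ^ (1 / 2 : ℂ) * ∑' n : ℤ, Complex.exp
        (-Real.pi * c * n ^ 2 + 2 * Real.pi * (-Complex.I * ((s / k : ℝ) : ℂ)) * n) := by
  have hc0 : c ≠ 0 := by
    rintro rfl
    simp at hc
  have hk0 : (k : ℂ) ≠ 0 := by exact_mod_cast hk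
  rw [Complex.tsum_exp_neg_quadratic hc, ← mul_assoc, mul_one_div_cancel, one_mul]
  · refine tsum_congr fun m => ?_
    congr 1
    have : Complex.I * (-Complex.I * ((s / k : ℝ) : ℂ)) = s / k := by
      push_cast
      linear_combination (-(s : ℂ) / k) * Complex.I_sq
    rw [this]
    field_simp
  · rw [Ne, Complex.cpow_eq_zero_iff]
    simp [hc0]

theorem tsum_int_eq_sum_residues {f : ℤ → ℂ} (hf : Summable f) (N : ℕ) [NeZero N] :
    ∑' n : ℤ, f n = ∑ j : Fin N, ∑' m : ℤ, f (m * N + (j : ℕ)) := by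
  let e : Fin N × ℤ ≃ ℤ := (Equiv.prodComm _ _).trans (Int.divModEquiv N).symm
  have hfe : Summable fun p => f (e p) := (e.summable_iff).2 hf
  rw [← e.tsum_eq, hfe.tsum_prod, tsum_fintype]
  rfl

theorem summable_exp_neg_mul_sq {a : ℂ} (ha : 0 < a.re) :
    Summable fun n : ℤ => Complex.exp (-Real.pi * a * (n : ℂ) ^ 2) := by
  refine ((summable_jacobiTheta₂_term_iff 0 (Complex.I * a)).2 (by simpa using ha)).congr
    fun n => ?_
  rw [jacobiTheta₂_term]
  congr 1
  linear_combination (Real.pi : ℂ) * a * (n : ℂ) ^ 2 * Complex.I_sq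

theorem Complex.ofReal_mul_cpow {t : ℝ} (ht : 0 < t) {z : ℂ} (hz : z ≠ 0) (w : ℂ) :
    ((t : ℂ) * z) ^ w = (t : ℂ) ^ w * z ^ w := by
  have ht0 : (t : ℂ) ≠ 0 := by exact_mod_cast ht.ne'
  rw [Complex.cpow_def_of_ne_zero (mul_ne_zero ht0 hz), Complex.cpow_def_of_ne_zero ht0,
    Complex.cpow_def_of_ne_zero hz, Complex.log_ofReal_mul ht hz, Complex.ofReal_log ht.le,
    add_mul, Complex.exp_add]

/-- With parameter `ε - 2i/N`, the oscillating part `e(n²/N)` depends only on `n` mod `N`; what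
remains is a Gaussian of parameter `ε`. -/
theorem exp_theta_left (N : ℕ) [NeZero N] (ε : ℝ) (hε : 0 < ε) (m : ℤ) (j : ℕ) :
    Complex.exp (-Real.pi * (ε - 2 * Complex.I / N) * ((m * N + j : ℤ) : ℂ) ^ 2) =
      rootExp N (1 * j ^ 2) *
        Complex.exp (-Real.pi / (((1 / (ε * N ^ 2) : ℝ) : ℂ) * N ^ 2) * (m * N + j) ^ 2) := by
  have hN : (N : ℂ) ≠ 0 := NeZero.ne _
  have hε' : (ε : ℂ) ≠ 0 := by exact_mod_cast hε.ne'
  rw [rootExp, ← Complex.exp_add, Complex.exp_eq_exp_iff_exists_int]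
  -- This integer is `((m N + j)² - j²) / N`.
  refine ⟨m ^ 2 * N + 2 * m * j, ?_⟩
  push_cast
  field_simp
  ring

/-- The dual parameter `1 / (ε - 2i/N)` is `iN/2` plus a term tending to `0` with `ε`. The part
`exp(-π i N n² / 2)` depends only on `n` mod `2`, which is why the dual sum is split into two
progressions. -/
theorem exp_theta_right (N : ℕ) [NeZero N] (ε : ℝ) (hε : 0 < ε) (m : ℤ) (s : ℕ) :
    Complex.exp (-Real.pi / (ε - 2 * Complex.I / N) * ((m * (2 : ℕ) + s : ℤ) : ℂ) ^ 2) =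
      Complex.exp (-Real.pi * Complex.I * N * s ^ 2 / 2) *
        Complex.exp (-Real.pi / ((((1 / (ε * N ^ 2) : ℝ) : ℂ) * (1 + Complex.I * N * ε / 2)) *
          (2 : ℕ) ^ 2) * (m * (2 : ℕ) + s) ^ 2) := by
  have hN : (N : ℂ) ≠ 0 := NeZero.ne _
  have hε' : (ε : ℂ) ≠ 0 := by exact_mod_cast hε.ne'
  have h1 : (N * ε - 2 * Complex.I : ℂ) ≠ 0 := by
    intro h
    have := congrArg Complex.im h
    simp at this
  have h2 : (2 + Complex.I * N * ε : ℂ) ≠ 0 := by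
    intro h
    have := congrArg Complex.re h
    simp at this
  have h3 : (ε - 2 * Complex.I / N : ℂ) = (N * ε - 2 * Complex.I) / N := by field_simp
  have h4 : (1 + Complex.I * N * ε / 2 : ℂ) = (2 + Complex.I * N * ε) / 2 := by ring
  have h5 : (2 + Complex.I * N * ε : ℂ) = Complex.I * (N * ε - 2 * Complex.I) := by
    linear_combination 2 * Complex.I_sq
  have h6 : 1 / (ε - 2 * Complex.I / N) = Complex.I * N / 2 +
      1 / ((((1 / (ε * N ^ 2) : ℝ) : ℂ) * (1 + Complex.I * N * ε / 2)) * (2 : ℕ) ^ 2) := by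
    rw [h3, h4]
    rw [h5] at h2 ⊢
    push_cast
    field_simp
    linear_combination (-(N : ℂ) * ε + 2 * Complex.I) * Complex.I_sq
  rw [← Complex.exp_add, Complex.exp_eq_exp_iff_exists_int]
  refine ⟨-(N * (m ^ 2 + m * s)), ?_⟩
  rw [div_eq_mul_one_div (-(Real.pi : ℂ)) (ε - _), h6]
  push_cast
  ring

/-- The functional equation at `ε - 2i/N`, split by residues mod `N` on one side and mod `2` on the
other. Both sides carry the divergent factor `(1 / (ε N²)) ^ (1/2)`; once it is cancelled, each has
a finite limit as `ε → 0`. -/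
theorem quadGauss_one_mul_theta (N : ℕ) [NeZero N] (ε : ℝ) (hε : 0 < ε) :
    ∑ j : Fin N, rootExp N (1 * (j : ℕ) ^ 2) * ∑' n : ℤ, Complex.exp
        (-Real.pi * ((1 / (ε * N ^ 2) : ℝ) : ℂ) * n ^ 2 +
          2 * Real.pi * (-Complex.I * (((j : ℕ) / N : ℝ) : ℂ)) * n) =
      1 / (ε - 2 * Complex.I / N : ℂ) ^ (1 / 2 : ℂ) *
        ((1 + Complex.I * N * ε / 2) ^ (1 / 2 : ℂ) *
      ∑ s : Fin 2, Complex.exp (-Real.pi * Complex.I * N * (s : ℕ) ^ 2 / 2) *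
        ∑' n : ℤ, Complex.exp
          (-Real.pi * (((1 / (ε * N ^ 2) : ℝ) : ℂ) * (1 + Complex.I * N * ε / 2)) * n ^ 2 +
          2 * Real.pi * (-Complex.I * (((s : ℕ) / (2 : ℕ) : ℝ) : ℂ)) * n)) := by
  have hN : (0 : ℝ) < N := by exact_mod_cast Nat.pos_of_ne_zero (NeZero.ne N)
  have ht : 0 < 1 / (ε * N ^ 2) := by positivity
  set t : ℝ := 1 / (ε * N ^ 2) with ht_def
  have ha : 0 < (ε - 2 * Complex.I / N : ℂ).re := by
    have : (2 * Complex.I / N : ℂ) = ((2 / N : ℝ) : ℂ) * Complex.I := by push_cast; ring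
    rw [this]
    simpa using hε
  have ha' : 0 < (1 / (ε - 2 * Complex.I / N : ℂ)).re := by
    rw [one_div, Complex.inv_re]
    exact div_pos ha (Complex.normSq_pos.2 fun h => by simp [h] at ha)
  have hz : 0 < ((t : ℂ) * (1 + Complex.I * N * ε / 2)).re := by
    rw [Complex.re_ofReal_mul]
    simpa using ht
  have hz0 : (1 + Complex.I * N * ε / 2 : ℂ) ≠ 0 := by
    intro h
    simp [h] at hz
  have hmain := Complex.tsum_exp_neg_mul_int_sq ha
  have hS := summable_exp_neg_mul_sq ha'
  simp_rw [mul_one_div] at hS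
  rw [tsum_int_eq_sum_residues (summable_exp_neg_mul_sq ha) N,
    tsum_int_eq_sum_residues hS 2] at hmain
  have hL : ∀ j : Fin N, ∑' m : ℤ,
      Complex.exp (-Real.pi * (ε - 2 * Complex.I / N) * ((m * N + (j : ℕ) : ℤ) : ℂ) ^ 2) =
      (t : ℂ) ^ (1 / 2 : ℂ) * (rootExp N (1 * (j : ℕ) ^ 2) * ∑' n : ℤ, Complex.exp
        (-Real.pi * (t : ℂ) * n ^ 2 +
          2 * Real.pi * (-Complex.I * (((j : ℕ) / N : ℝ) : ℂ)) * n)) := by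
    intro j
    simp_rw [exp_theta_left N ε hε]
    rw [tsum_mul_left, tsum_gaussian_progression (by rwa [Complex.ofReal_re]) (NeZero.ne N)]
    ring
  have hR : ∀ s : Fin 2, ∑' m : ℤ,
      Complex.exp (-Real.pi / (ε - 2 * Complex.I / N) *
        ((m * (2 : ℕ) + (s : ℕ) : ℤ) : ℂ) ^ 2) =
      (t : ℂ) ^ (1 / 2 : ℂ) * ((1 + Complex.I * N * ε / 2) ^ (1 / 2 : ℂ) *
        (Complex.exp (-Real.pi * Complex.I * N * (s : ℕ) ^ 2 / 2) *
        ∑' n : ℤ, Complex.exp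
          (-Real.pi * ((t : ℂ) * (1 + Complex.I * N * ε / 2)) * n ^ 2 +
          2 * Real.pi * (-Complex.I * (((s : ℕ) / (2 : ℕ) : ℝ) : ℂ)) * n))) := by
    intro s
    simp_rw [exp_theta_right N ε hε]
    rw [tsum_mul_left, tsum_gaussian_progression hz two_ne_zero,
      Complex.ofReal_mul_cpow ht hz0]
    ring
  simp_rw [hL, hR, ← Finset.mul_sum] at hmain
  have ht0 : (t : ℂ) ^ (1 / 2 : ℂ) ≠ 0 := by
    rw [Ne, Complex.cpow_eq_zero_iff]
    simp [ht.ne']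
  refine mul_left_cancel₀ ht0 (hmain.trans ?_)
  ring

open Filter Topology in
theorem quadGauss_one_left (N : ℕ) [NeZero N] :
    quadGauss 1 N = Real.sqrt N * (1 + Complex.I) / 2 * (1 + (-Complex.I) ^ N) := by
  have hN : (0 : ℝ) < N := by exact_mod_cast Nat.pos_of_ne_zero (NeZero.ne N)
  have hNC : (N : ℂ) ≠ 0 := NeZero.ne _
  have hid : Tendsto (fun ε : ℝ => ε) (𝓝[>] 0) (𝓝 0) := tendsto_nhdsWithin_of_tendsto_nhds tendsto_id
  have hidC : Tendsto (fun ε : ℝ => (ε : ℂ)) (𝓝[>] 0) (𝓝 0) := by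
    simpa [Function.comp_def] using (Complex.continuous_ofReal.tendsto 0).comp hid
  have ht : Tendsto (fun ε : ℝ => 1 / (ε * (N : ℝ) ^ 2)) (𝓝[>] 0) atTop := by
    have := tendsto_inv_nhdsGT_zero (𝕜 := ℝ) |>.atTop_mul_const (r := ((N : ℝ) ^ 2)⁻¹) (by positivity)
    refine this.congr fun ε => ?_
    rw [one_div, mul_inv]
  have h1 : Tendsto (fun ε : ℝ => ∑ j : Fin N, rootExp N (1 * (j : ℕ) ^ 2) *
      ∑' n : ℤ, Complex.exp (-Real.pi * ((1 / (ε * N ^ 2) : ℝ) : ℂ) * n ^ 2 +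
          2 * Real.pi * (-Complex.I * (((j : ℕ) / N : ℝ) : ℂ)) * n)) (𝓝[>] 0)
      (𝓝 (∑ j : Fin N, rootExp N (1 * (j : ℕ) ^ 2) * 1)) := by
    refine tendsto_finsetSum _ fun j _ => Tendsto.const_mul _ ?_
    exact tendsto_tsum_gaussian (by simpa only [Complex.ofReal_re] using ht) _
  have h2 : Tendsto (fun ε : ℝ => ∑ s : Fin 2,
      Complex.exp (-Real.pi * Complex.I * N * (s : ℕ) ^ 2 / 2) *
        ∑' n : ℤ, Complex.exp
          (-Real.pi * (((1 / (ε * N ^ 2) : ℝ) : ℂ) * (1 + Complex.I * N * ε / 2)) * n ^ 2 +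
          2 * Real.pi * (-Complex.I * (((s : ℕ) / (2 : ℕ) : ℝ) : ℂ)) * n)) (𝓝[>] 0)
      (𝓝 (∑ s : Fin 2, Complex.exp (-Real.pi * Complex.I * N * (s : ℕ) ^ 2 / 2) * 1)) := by
    refine tendsto_finsetSum _ fun j _ => Tendsto.const_mul _ ?_
    refine tendsto_tsum_gaussian (ht.congr fun ε => ?_) _
    rw [Complex.re_ofReal_mul]
    simp
  -- `(1 - i)² = -2i`, and `1 - i` has positive real part, so this is the principal square root.
  have hroot : (((1 - Complex.I) / Real.sqrt N) ^ 2 : ℂ) = 0 - 2 * Complex.I / N := by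
    have hs : ((Real.sqrt N : ℝ) : ℂ) ^ 2 = N := by
      rw [← Complex.ofReal_pow, Real.sq_sqrt hN.le, Complex.ofReal_natCast]
    rw [div_pow, hs]
    field_simp
    linear_combination Complex.I_sq
  have hsq : (0 - 2 * Complex.I / N : ℂ) ^ (1 / 2 : ℂ) = (1 - Complex.I) / Real.sqrt N := by
    rw [← hroot, one_div]
    refine Complex.sq_cpow_two_inv ?_
    rw [Complex.div_ofReal_re]
    simpa using hN
  have hslit : (0 - 2 * Complex.I / N : ℂ) ∈ Complex.slitPlane := by
    right
    have : (0 - 2 * Complex.I / N : ℂ) = ((-2 / N : ℝ) : ℂ) * Complex.I := by push_cast; ring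
    rw [this]
    simpa using hN.ne'
  have h1I : (1 - Complex.I : ℂ) ≠ 0 := by
    intro h
    have := congrArg Complex.re h
    simp at this
  have hsN : ((Real.sqrt N : ℝ) : ℂ) ≠ 0 := by
    exact_mod_cast (Real.sqrt_pos.2 hN).ne'
  have h3 : Tendsto (fun ε : ℝ => 1 / (ε - 2 * Complex.I / N : ℂ) ^ (1 / 2 : ℂ)) (𝓝[>] 0)
      (𝓝 (1 / (0 - 2 * Complex.I / N : ℂ) ^ (1 / 2 : ℂ))) := by
    refine Tendsto.div tendsto_const_nhds ?_ ?_
    · exact (hidC.sub_const _).cpow tendsto_const_nhds hslit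
    · rw [hsq]
      exact div_ne_zero h1I hsN
  have h4 : Tendsto (fun ε : ℝ => (1 + Complex.I * N * ε / 2 : ℂ) ^ (1 / 2 : ℂ)) (𝓝[>] 0)
      (𝓝 1) := by
    have : Tendsto (fun ε : ℝ => (1 + Complex.I * N * ε / 2 : ℂ)) (𝓝[>] 0) (𝓝 1) := by
      simpa using ((hidC.const_mul (Complex.I * N)).div_const 2).const_add 1
    simpa using this.cpow (tendsto_const_nhds (x := (1 / 2 : ℂ))) (by simp)
  have hlim := tendsto_nhds_unique (h1.congr' ?_) (h3.mul (h4.mul h2))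
  · simp only [mul_one] at hlim
    rw [quadGauss, hlim, hsq, Fin.sum_univ_two]
    have hexp : Complex.exp (-Real.pi * Complex.I * N * ((1 : Fin 2) : ℕ) ^ 2 / 2) =
        (-Complex.I) ^ N := by
      rw [← Complex.exp_neg_pi_div_two_mul_I, ← Complex.exp_nat_mul]
      congr 1
      simp
      ring
    rw [hexp]
    simp only [Fin.val_zero, Nat.cast_zero]
    rw [show (-(Real.pi : ℂ) * Complex.I * N * 0 ^ 2 / 2) = 0 by ring, Complex.exp_zero]
    field_simp
    linear_combination (1 + (-Complex.I) ^ N) * Complex.I_sq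
  · filter_upwards [self_mem_nhdsWithin] with ε hε
    exact quadGauss_one_mul_theta N ε hε

/-! ### Values of `G(r, n)` by residues mod 4 -/

theorem quadGauss_one_of_mod_four_eq_zero {N : ℕ} [NeZero N] (h : N % 4 = 0) :
    quadGauss 1 N = Real.sqrt N * (1 + Complex.I) := by
  rw [quadGauss_one_left, ← Nat.div_add_mod N 4, h, pow_add, pow_mul]
  have : (-Complex.I) ^ 4 = 1 := by rw [neg_pow, Complex.I_pow_four]; norm_num
  rw [this]
  simp
  ring

theorem quadGauss_one_of_mod_four_eq_one {N : ℕ} [NeZero N] (h : N % 4 = 1) :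
    quadGauss 1 N = Real.sqrt N := by
  have h4 : (-Complex.I) ^ N = -Complex.I := by
    rw [← Nat.div_add_mod N 4, h, pow_add, pow_mul, neg_pow, Complex.I_pow_four]
    norm_num
  rw [quadGauss_one_left, h4]
  linear_combination (-(Real.sqrt N : ℂ) / 2) * Complex.I_sq

theorem quadGauss_one_of_mod_four_eq_two {N : ℕ} [NeZero N] (h : N % 4 = 2) :
    quadGauss 1 N = 0 := by
  have h4 : (-Complex.I) ^ N = -1 := by
    rw [← Nat.div_add_mod N 4, h, pow_add, pow_mul, neg_pow, Complex.I_pow_four]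
    norm_num
  rw [quadGauss_one_left, h4]
  ring

theorem quadGauss_one_of_mod_four_eq_three {N : ℕ} [NeZero N] (h : N % 4 = 3) :
    quadGauss 1 N = Real.sqrt N * Complex.I := by
  have h4 : (-Complex.I) ^ N = Complex.I := by
    rw [← Nat.div_add_mod N 4, h, pow_add, pow_mul, neg_pow, Complex.I_pow_four,
      neg_pow Complex.I 3, Complex.I_pow_three]
    norm_num
  rw [quadGauss_one_left, h4]
  linear_combination ((Real.sqrt N : ℂ) / 2) * Complex.I_sq

/-- Meant for even `n`, where `quadGauss_odd` does not apply to `G(r, n)` but does apply to the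
complementary factor `G(n, r)`. -/
theorem quadGauss_mul_quadGauss {n r : ℕ} (hn : n ≠ 0) (hr : Odd r) (h : r.Coprime n) :
    quadGauss r n * (jacobiSym n r * quadGauss 1 r) = quadGauss 1 (n * r) := by
  rw [quadGauss_mul 1 hn hr.pos.ne' h.symm, one_mul, one_mul, quadGauss_odd hr h.symm]

theorem ofReal_sqrt_natCast_ne_zero (n : ℕ) [NeZero n] : ((Real.sqrt n : ℝ) : ℂ) ≠ 0 := by
  have : (0 : ℝ) < n := by exact_mod_cast Nat.pos_of_ne_zero (NeZero.ne n)
  exact_mod_cast (Real.sqrt_pos.2 this).ne'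

theorem jacobiSym_natCast_sq {a b : ℕ} (h : a.Coprime b) : (jacobiSym a b : ℂ) ^ 2 = 1 := by
  exact_mod_cast jacobiSym.sq_one (by simpa using h)

theorem quadGauss_zero_mod_four_one_mod_four {n r : ℕ} [NeZero n] (hn : n % 4 = 0) (hr : r % 4 = 1)
    (h : r.Coprime n) : quadGauss r n = Real.sqrt n * (jacobiSym n r * (1 + Complex.I)) := by
  have : NeZero r := ⟨by omega⟩
  have hrn : (n * r) % 4 = 0 := by simp [Nat.mul_mod, hn]
  have key := quadGauss_mul_quadGauss (NeZero.ne n) (Nat.odd_iff.2 (by omega)) h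
  rw [quadGauss_one_of_mod_four_eq_one hr, quadGauss_one_of_mod_four_eq_zero hrn, Nat.cast_mul,
    Real.sqrt_mul n.cast_nonneg, Complex.ofReal_mul] at key
  have hr0 := ofReal_sqrt_natCast_ne_zero r
  refine mul_right_cancel₀ hr0 ?_
  -- The Jacobi symbol is its own inverse, so multiplying by it moves it to the other side.
  linear_combination (jacobiSym n r : ℂ) * key -
    quadGauss r n * Real.sqrt r * jacobiSym_natCast_sq h.symm

theorem quadGauss_zero_mod_four_three_mod_four {n r : ℕ} [NeZero n] (hn : n % 4 = 0)
    (hr : r % 4 = 3) (h : r.Coprime n) :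
    quadGauss r n = Real.sqrt n * (jacobiSym n r * (1 - Complex.I)) := by
  have : NeZero r := ⟨by omega⟩
  have hrn : (n * r) % 4 = 0 := by simp [Nat.mul_mod, hn]
  have key := quadGauss_mul_quadGauss (NeZero.ne n) (Nat.odd_iff.2 (by omega)) h
  rw [quadGauss_one_of_mod_four_eq_three hr, quadGauss_one_of_mod_four_eq_zero hrn, Nat.cast_mul,
    Real.sqrt_mul n.cast_nonneg, Complex.ofReal_mul] at key
  have hr0 := ofReal_sqrt_natCast_ne_zero r
  refine mul_right_cancel₀ (mul_ne_zero hr0 Complex.I_ne_zero) ?_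
  linear_combination (jacobiSym n r : ℂ) * key -
    quadGauss r n * Real.sqrt r * Complex.I * jacobiSym_natCast_sq h.symm +
    Real.sqrt n * Real.sqrt r * jacobiSym n r * Complex.I_sq

/-- Since `r` is odd, `n r` is also `2` mod `4` and `G(1, n r) = 0`; the cofactor of `G(r, n)` in
the product formula is nonzero. -/
theorem quadGauss_two_mod_four {n r : ℕ} [NeZero n] (hn : n % 4 = 2) (h : r.Coprime n) :
    quadGauss r n = 0 := by
  have hr : Odd r := by
    refine Nat.coprime_two_left.1 ?_
    exact (h.coprime_dvd_right (Nat.dvd_of_mod_eq_zero (by omega))).symm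
  have hr2 := Nat.odd_iff.1 hr
  have : NeZero r := ⟨by omega⟩
  have hrn : (n * r) % 4 = 2 := by
    rcases (by omega : r % 4 = 1 ∨ r % 4 = 3) with h | h <;> simp [Nat.mul_mod, hn, h]
  have key := quadGauss_mul_quadGauss (NeZero.ne n) hr h
  rw [quadGauss_one_of_mod_four_eq_two hrn] at key
  refine (mul_eq_zero.1 key).resolve_right (mul_ne_zero ?_ ?_)
  · intro h0
    have := jacobiSym_natCast_sq h.symm
    simp [h0] at this
  · rcases (by omega : r % 4 = 1 ∨ r % 4 = 3) with h | h
    · rw [quadGauss_one_of_mod_four_eq_one h]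
      exact ofReal_sqrt_natCast_ne_zero r
    · rw [quadGauss_one_of_mod_four_eq_three h]
      exact mul_ne_zero (ofReal_sqrt_natCast_ne_zero r) Complex.I_ne_zero

/-! ### Eigenspaces of an endomorphism with `f ^ 4 = 1` -/

section FourthRoot

variable {V : Type*} [AddCommGroup V] [Module ℂ V]

/-- The spectral projection onto the `μ`-eigenspace of an endomorphism `f` with `f ^ 4 = 1`, for a
fourth root of unity `μ`. -/
noncomputable def fourthRootProj (f : Module.End ℂ V) (μ : ℂ) : Module.End ℂ V :=
  (1 / 4 : ℂ) • (1 + μ ^ 3 • f + μ ^ 2 • f ^ 2 + μ • f ^ 3)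

/-- The coefficients are `μ^{-j} = μ^{4-j}`: applying `f` to the average shifts it cyclically, which
multiplies it by `μ`, and on the eigenspace all four terms agree. -/
theorem isProj_fourthRootProj {f : Module.End ℂ V} (hf : f ^ 4 = 1) {μ : ℂ} (hμ : μ ^ 4 = 1) :
    LinearMap.IsProj (f.eigenspace μ) (fourthRootProj f μ) := by
  constructor
  · intro x
    have h4 : f (f (f (f x))) = x := by
      have := congrArg (fun g : Module.End ℂ V => g x) hf
      simpa [pow_succ] using this
    rw [Module.End.mem_eigenspace_iff]
    simp only [fourthRootProj, LinearMap.smul_apply, LinearMap.add_apply, Module.End.one_apply,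
      pow_succ, pow_zero, Module.End.mul_apply, map_smul, map_add, one_mul]
    rw [h4]
    have h5 : μ * μ * μ * μ = 1 := by rw [← hμ]; ring
    have h6 : μ • (μ * μ * μ) • f x = f x := by
      rw [smul_smul, show μ * (μ * μ * μ) = 1 by rw [← h5]; ring, one_smul]
    rw [smul_comm μ (1 / 4 : ℂ), smul_add μ, smul_add μ, smul_add μ, h6]
    module
  · intro x hx
    rw [Module.End.mem_eigenspace_iff] at hx
    have h4 : ∀ c : ℂ, (c * μ ^ 4) • x = c • x := fun c => by rw [hμ, mul_one]
    simp only [fourthRootProj, LinearMap.smul_apply, LinearMap.add_apply, Module.End.one_apply,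
      pow_succ f, pow_zero, Module.End.mul_apply, map_smul, hx, one_mul, smul_smul]
    rw [show μ ^ 3 * μ = 1 by rw [← hμ]; ring, show μ ^ 2 * (μ * μ) = 1 by rw [← hμ]; ring,
      show μ * (μ * (μ * μ)) = 1 by rw [← hμ]; ring]
    module

/-- The rank of a projection is its trace. -/
theorem finrank_eigenspace_of_pow_four_eq_one [FiniteDimensional ℂ V] {f : Module.End ℂ V}
    (hf : f ^ 4 = 1) {μ : ℂ} (hμ : μ ^ 4 = 1) :
    (Module.finrank ℂ (f.eigenspace μ) : ℂ) =
      1 / 4 * (Module.finrank ℂ V + μ ^ 3 * LinearMap.trace ℂ V f +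
        μ ^ 2 * LinearMap.trace ℂ V (f ^ 2) + μ * LinearMap.trace ℂ V (f ^ 3)) := by
  rw [← (isProj_fourthRootProj hf hμ).trace, fourthRootProj]
  simp only [map_smul, map_add, LinearMap.trace_one, smul_eq_mul]

/-- `f` is annihilated by the separable polynomial `X⁴ - 1`, hence semisimple, so generalized
eigenspaces are eigenspaces. -/
theorem rootMultiplicity_charpoly_of_pow_four_eq_one [FiniteDimensional ℂ V] {f : Module.End ℂ V}
    (hf : f ^ 4 = 1) (μ : ℂ) :
    f.charpoly.rootMultiplicity μ = Module.finrank ℂ (f.eigenspace μ) := by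
  have hss : f.IsSemisimple := by
    refine Module.End.isSemisimple_of_squarefree_aeval_eq_zero
      (p := Polynomial.X ^ 4 - Polynomial.C (1 : ℂ)) ?_ (by simp [hf])
    exact (Polynomial.separable_X_pow_sub_C (1 : ℂ) (by norm_num) one_ne_zero).squarefree
  rw [← LinearMap.finrank_maxGenEigenspace_eq,
    hss.isFinitelySemisimple.maxGenEigenspace_eq_eigenspace]

end FourthRoot

theorem hasEigenvalueMultiplicity_of_pow_four_eq_one {n : ℕ} [NeZero n]
    {M : Matrix (ZMod n) (ZMod n) ℂ} (hM : M ^ 4 = 1) {μ : ℂ} (hμ : μ ^ 4 = 1) {t : ℤ}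
    (ht : 4 * (t : ℂ) = n + μ ^ 3 * M.trace + μ ^ 2 * (M ^ 2).trace + μ * (M ^ 3).trace) :
    HasEigenvalueMultiplicity M μ t := by
  have hf : (Matrix.toLin' M) ^ 4 = 1 := by
    rw [← Matrix.toLin'_pow, hM, Matrix.toLin'_one]
    rfl
  have hgeom : (Module.finrank ℂ (Module.End.eigenspace (Matrix.toLin' M) μ) : ℤ) = t := by
    have h := finrank_eigenspace_of_pow_four_eq_one hf hμ
    rw [← Matrix.toLin'_pow, ← Matrix.toLin'_pow, Matrix.trace_toLin'_eq, Matrix.trace_toLin'_eq,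
      Matrix.trace_toLin'_eq, Module.finrank_fintype_fun_eq_card, ZMod.card, ← ht] at h
    have h' : ((Module.finrank ℂ (Module.End.eigenspace (Matrix.toLin' M) μ) : ℤ) : ℂ) = t := by
      rw [Int.cast_natCast, h]
      ring
    exact_mod_cast h'
  refine ⟨?_, hgeom⟩
  rw [← hgeom, ← rootMultiplicity_charpoly_of_pow_four_eq_one hf, Matrix.charpoly_toLin']

/-! ### Powers and traces of the permuted Fourier matrix -/

section PermutedFourier

variable {n : ℕ} [NeZero n] (m : (ZMod n)ˣ)

theorem permutedFourierMatrix_apply (j k : ZMod n) :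
    permutedFourierMatrix n m j k =
      1 / (Real.sqrt n : ℂ) * ZMod.stdAddChar ((m : ZMod n) * j * k) := by
  rw [permutedFourierMatrix, Matrix.mul_apply, Finset.sum_eq_single (mulPerm m k)]
  · have h : (mulPerm m k : ZMod n) = m * k := rfl
    have hval : ((m : ZMod n) * j * k) = ((j.val * (mulPerm m k).val : ℕ) : ZMod n) := by
      push_cast
      rw [ZMod.natCast_zmod_val, ZMod.natCast_zmod_val, h]
      ring
    rw [hval, ← rootExp_eq_stdAddChar, rootExp, fourierMatrix, permutationMatrix]
    simp only [Matrix.of_apply, if_true, mul_one]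
    push_cast
    congr 2
    ring
  · intro l _ hl
    simp [permutationMatrix, hl]
  · simp

/-- The entry is `1/n` times the full sum of a character of frequency `m (j + k)`; as `m` is a unit,
it is nonzero only for `j = -k`. -/
theorem permutedFourierMatrix_sq_apply (j k : ZMod n) :
    (permutedFourierMatrix n m ^ 2) j k = if j = -k then 1 else 0 := by
  have hs : (Real.sqrt n : ℂ) * (Real.sqrt n : ℂ) = n := by
    rw [← Complex.ofReal_mul, Real.mul_self_sqrt n.cast_nonneg, Complex.ofReal_natCast]
  have hn : (n : ℂ) ≠ 0 := NeZero.ne _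
  have hterm : ∀ l : ZMod n, permutedFourierMatrix n m j l * permutedFourierMatrix n m l k =
      1 / (n : ℂ) * ZMod.stdAddChar (l * ((m : ZMod n) * (j + k))) := by
    intro l
    rw [permutedFourierMatrix_apply, permutedFourierMatrix_apply, ← hs,
      show l * ((m : ZMod n) * (j + k)) = m * j * l + m * l * k by ring, AddChar.map_add_eq_mul]
    ring
  rw [sq, Matrix.mul_apply, Finset.sum_congr rfl fun l _ => hterm l, ← Finset.mul_sum,
    AddChar.sum_mulShift _ (ZMod.isPrimitive_stdAddChar n), ZMod.card]
  simp only [Units.mul_right_eq_zero, add_eq_zero_iff_eq_neg]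
  split_ifs
  · exact one_div_mul_cancel hn
  · simp

theorem mul_permutedFourierMatrix_sq_apply (A : Matrix (ZMod n) (ZMod n) ℂ) (j k : ZMod n) :
    (A * permutedFourierMatrix n m ^ 2) j k = A j (-k) := by
  simp [Matrix.mul_apply, permutedFourierMatrix_sq_apply]

theorem permutedFourierMatrix_pow_four : permutedFourierMatrix n m ^ 4 = 1 := by
  ext j k
  rw [show 4 = 2 + 2 from rfl, pow_add, mul_permutedFourierMatrix_sq_apply,
    permutedFourierMatrix_sq_apply, neg_neg, Matrix.one_apply]

theorem trace_permutedFourierMatrix {m : (ZMod n)ˣ} {r : ℕ} (hr : (r : ZMod n) = (m : ZMod n)) :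
    (permutedFourierMatrix n m).trace = 1 / (Real.sqrt n : ℂ) * quadGauss r n := by
  rw [quadGauss_eq_sum_zmod, Finset.mul_sum, Matrix.trace]
  refine Finset.sum_congr rfl fun j _ => ?_
  rw [Matrix.diag_apply, permutedFourierMatrix_apply, hr, sq, mul_assoc]

/-- The factor `M ^ 2` negates the column index, which conjugates the character value on the
diagonal. -/
theorem trace_permutedFourierMatrix_pow_three :
    (permutedFourierMatrix n m ^ 3).trace =
      starRingEnd ℂ (permutedFourierMatrix n m).trace := by
  rw [Matrix.trace, Matrix.trace, map_sum]
  refine Finset.sum_congr rfl fun j _ => ?_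
  rw [Matrix.diag_apply, Matrix.diag_apply, show 3 = 1 + 2 from rfl, pow_add, pow_one,
    mul_permutedFourierMatrix_sq_apply, permutedFourierMatrix_apply, permutedFourierMatrix_apply,
    mul_neg, AddChar.map_neg_eq_conj]
  simp

end PermutedFourier

/-- The trace counts the solutions of `j = -j`: `0` always, and also `n / 2` when `n` is even. -/
theorem trace_permutedFourierMatrix_sq {n : ℕ} [NeZero n] (m : (ZMod n)ˣ) :
    (permutedFourierMatrix n m ^ 2).trace = ((2 - n % 2 : ℤ) : ℂ) := by
  have h1 : (permutedFourierMatrix n m ^ 2).trace =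
      ((Finset.univ.filter fun j : ZMod n => j = -j).card : ℂ) := by
    simp [Matrix.trace, permutedFourierMatrix_sq_apply, Finset.sum_boole]
  have h0 := Nat.pos_of_ne_zero (NeZero.ne n)
  rw [h1]
  have hiff : ∀ j : ZMod n, j = -j ↔ j = 0 ∨ 2 * j.val = n := fun j => by
    rw [eq_comm, ZMod.neg_eq_self_iff]
  simp_rw [hiff]
  rcases Nat.mod_two_eq_zero_or_one n with h | h
  · have hlt : n / 2 < n := by omega
    have hval : ((n / 2 : ℕ) : ZMod n).val = n / 2 := ZMod.val_cast_of_lt hlt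
    have : (Finset.univ.filter fun j : ZMod n => j = 0 ∨ 2 * j.val = n) =
        {0, ((n / 2 : ℕ) : ZMod n)} := by
      ext j
      simp only [Finset.mem_filter, Finset.mem_univ, true_and, Finset.mem_insert,
        Finset.mem_singleton]
      refine or_congr_right ⟨fun hj => ?_, fun hj => ?_⟩
      · rw [show n / 2 = j.val by omega, ZMod.natCast_zmod_val]
      · rw [hj, hval]
        omega
    have hne : (0 : ZMod n) ≠ ((n / 2 : ℕ) : ZMod n) := by
      intro hz
      rw [← hz, ZMod.val_zero] at hval
      omega
    rw [this, Finset.card_pair hne]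
    have : ((n : ℤ) % 2) = 0 := by omega
    rw [this]
    norm_num
  · have : (Finset.univ.filter fun j : ZMod n => j = 0 ∨ 2 * j.val = n) = {0} := by
      ext j
      simp only [Finset.mem_filter, Finset.mem_univ, true_and, Finset.mem_singleton]
      refine or_iff_left ?_
      omega
    rw [this, Finset.card_singleton]
    have : ((n : ℤ) % 2) = 1 := by omega
    rw [this]
    norm_num

/-! ### Reading the table off the Gauss sum -/

/-- If the Gauss sum is `√n (x + y i)` with integers `x` and `y`, then these integers determine the
multiplicities of all eigenvalues. -/
theorem hasTraceAndMultiplicities_of_quadGauss {n : ℕ} [NeZero n] {m : (ZMod n)ˣ} {r : ℕ}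
    (hr : (r : ZMod n) = (m : ZMod n)) {x y a b c d : ℤ}
    (hG : quadGauss r n = Real.sqrt n * (x + y * Complex.I))
    (ha : 4 * a = n + (2 - n % 2) + 2 * x) (hb : 4 * b = n + (2 - n % 2) - 2 * x)
    (hc : 4 * c = n - (2 - n % 2) + 2 * y) (hd : 4 * d = n - (2 - n % 2) - 2 * y) :
    HasTraceAndMultiplicities (permutedFourierMatrix n m) (x + y * Complex.I) a b c d := by
  have htr : (permutedFourierMatrix n m).trace = x + y * Complex.I := by
    rw [trace_permutedFourierMatrix hr, hG, ← mul_assoc,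
      one_div_mul_cancel (ofReal_sqrt_natCast_ne_zero n), one_mul]
  have htr3 : (permutedFourierMatrix n m ^ 3).trace = x - y * Complex.I := by
    rw [trace_permutedFourierMatrix_pow_three m, htr]
    simp [sub_eq_add_neg]
  have hs := trace_permutedFourierMatrix_sq m
  generalize (2 - n % 2 : ℤ) = s at *
  have hM := permutedFourierMatrix_pow_four m
  have cast : ∀ {u v : ℤ}, u = v → (u : ℂ) = v := fun h => by rw [h]
  have ha' := cast ha
  have hb' := cast hb
  have hc' := cast hc
  have hd' := cast hd
  push_cast at ha' hb' hc' hd'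
  -- In the projection formula `tr M` and its conjugate combine to `±2x` at `μ = ±1` and to `±2y` at
  -- `μ = ±i`, while `tr M ^ 2` enters with sign `μ²`.
  refine ⟨htr, ?_, ?_, ?_, ?_⟩ <;>
    refine hasEigenvalueMultiplicity_of_pow_four_eq_one hM ?_ ?_
  · norm_num
  · rw [htr, htr3, hs, ha']
    ring
  · norm_num
  · rw [htr, htr3, hs, hb']
    ring
  · exact Complex.I_pow_four
  · rw [htr, htr3, hs, hc', Complex.I_pow_three, Complex.I_sq]
    linear_combination (2 * y : ℂ) * Complex.I_sq
  · rw [neg_pow, Complex.I_pow_four]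
    norm_num
  · rw [htr, htr3, hs, hd', neg_pow, neg_pow Complex.I 2, Complex.I_pow_three, Complex.I_sq]
    linear_combination (-2 * y : ℂ) * Complex.I_sq

theorem theorem4p5 (n : ℕ) [NeZero n] (m : (ZMod n)ˣ) (hm : m ≠ 1)
    (r : ℕ) (hr : (r : ZMod n) = (m : ZMod n)) (k : ℕ) :
    (n = 4 * k → r % 4 = 1 → jacobiSym n r = 1 →
      HasTraceAndMultiplicities (permutedFourierMatrix n m)
        (1 + Complex.I) (k + 1) k k (k - 1)) ∧
    (n = 4 * k → r % 4 = 1 → jacobiSym n r = -1 →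
      HasTraceAndMultiplicities (permutedFourierMatrix n m)
        (-1 - Complex.I) k (k + 1) (k - 1) k) ∧
    (n = 4 * k → r % 4 = 3 → jacobiSym n r = 1 →
      HasTraceAndMultiplicities (permutedFourierMatrix n m)
        (1 - Complex.I) (k + 1) k (k - 1) k) ∧
    (n = 4 * k → r % 4 = 3 → jacobiSym n r = -1 →
      HasTraceAndMultiplicities (permutedFourierMatrix n m)
        (-1 + Complex.I) k (k + 1) k (k - 1)) ∧
    (n = 4 * k + 1 → jacobiSym r n = 1 →
      HasTraceAndMultiplicities (permutedFourierMatrix n m)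
        1 (k + 1) k k k) ∧
    (n = 4 * k + 1 → jacobiSym r n = -1 →
      HasTraceAndMultiplicities (permutedFourierMatrix n m)
        (-1) k (k + 1) k k) ∧
    (n = 4 * k + 2 →
      HasTraceAndMultiplicities (permutedFourierMatrix n m)
        0 (k + 1) (k + 1) k k) ∧
    (n = 4 * k + 3 → jacobiSym r n = 1 →
      HasTraceAndMultiplicities (permutedFourierMatrix n m)
        Complex.I (k + 1) (k + 1) (k + 1) k) ∧
    (n = 4 * k + 3 → jacobiSym r n = -1 →
      HasTraceAndMultiplicities (permutedFourierMatrix n m)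
        (-Complex.I) (k + 1) (k + 1) k (k + 1)) := by
  -- In every row only the integers `x`, `y` with `G(r, n) = √n (x + y i)` are needed; the four
  -- multiplicities follow by linear arithmetic in `n` and its parity.
  have hcop : r.Coprime n := (ZMod.isUnit_iff_coprime r n).1 (hr ▸ m.isUnit)
  refine ⟨fun hn h4 hJ => ?_, fun hn h4 hJ => ?_, fun hn h4 hJ => ?_, fun hn h4 hJ => ?_,
    fun hn hJ => ?_, fun hn hJ => ?_, fun hn => ?_, fun hn hJ => ?_, fun hn hJ => ?_⟩
  · have hG : quadGauss r n = Real.sqrt n * (((1 : ℤ) : ℂ) + ((1 : ℤ) : ℂ) * Complex.I) := by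
      rw [quadGauss_zero_mod_four_one_mod_four (by omega) h4 hcop, hJ]
      push_cast
      ring
    rw [show (1 + Complex.I : ℂ) = ((1 : ℤ) : ℂ) + ((1 : ℤ) : ℂ) * Complex.I by push_cast; ring]
    exact hasTraceAndMultiplicities_of_quadGauss hr hG (by omega) (by omega) (by omega) (by omega)
  · have hG : quadGauss r n = Real.sqrt n * (((-1 : ℤ) : ℂ) + ((-1 : ℤ) : ℂ) * Complex.I) := by
      rw [quadGauss_zero_mod_four_one_mod_four (by omega) h4 hcop, hJ]
      push_cast
      ring
    rw [show (-1 - Complex.I : ℂ) = ((-1 : ℤ) : ℂ) + ((-1 : ℤ) : ℂ) * Complex.I by push_cast; ring]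
    exact hasTraceAndMultiplicities_of_quadGauss hr hG (by omega) (by omega) (by omega) (by omega)
  · have hG : quadGauss r n = Real.sqrt n * (((1 : ℤ) : ℂ) + ((-1 : ℤ) : ℂ) * Complex.I) := by
      rw [quadGauss_zero_mod_four_three_mod_four (by omega) h4 hcop, hJ]
      push_cast
      ring
    rw [show (1 - Complex.I : ℂ) = ((1 : ℤ) : ℂ) + ((-1 : ℤ) : ℂ) * Complex.I by push_cast; ring]
    exact hasTraceAndMultiplicities_of_quadGauss hr hG (by omega) (by omega) (by omega) (by omega)
  · have hG : quadGauss r n = Real.sqrt n * (((-1 : ℤ) : ℂ) + ((1 : ℤ) : ℂ) * Complex.I) := by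
      rw [quadGauss_zero_mod_four_three_mod_four (by omega) h4 hcop, hJ]
      push_cast
      ring
    rw [show (-1 + Complex.I : ℂ) = ((-1 : ℤ) : ℂ) + ((1 : ℤ) : ℂ) * Complex.I by push_cast; ring]
    exact hasTraceAndMultiplicities_of_quadGauss hr hG (by omega) (by omega) (by omega) (by omega)
  · have hG : quadGauss r n = Real.sqrt n * (((1 : ℤ) : ℂ) + ((0 : ℤ) : ℂ) * Complex.I) := by
      rw [quadGauss_odd (Nat.odd_iff.2 (by omega)) hcop, hJ,
        quadGauss_one_of_mod_four_eq_one (by omega)]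
      push_cast
      ring
    rw [show (1 : ℂ) = ((1 : ℤ) : ℂ) + ((0 : ℤ) : ℂ) * Complex.I by push_cast; ring]
    exact hasTraceAndMultiplicities_of_quadGauss hr hG (by omega) (by omega) (by omega) (by omega)
  · have hG : quadGauss r n = Real.sqrt n * (((-1 : ℤ) : ℂ) + ((0 : ℤ) : ℂ) * Complex.I) := by
      rw [quadGauss_odd (Nat.odd_iff.2 (by omega)) hcop, hJ,
        quadGauss_one_of_mod_four_eq_one (by omega)]
      push_cast
      ring
    rw [show (-1 : ℂ) = ((-1 : ℤ) : ℂ) + ((0 : ℤ) : ℂ) * Complex.I by push_cast; ring]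
    exact hasTraceAndMultiplicities_of_quadGauss hr hG (by omega) (by omega) (by omega) (by omega)
  · have hG : quadGauss r n = Real.sqrt n * (((0 : ℤ) : ℂ) + ((0 : ℤ) : ℂ) * Complex.I) := by
      rw [quadGauss_two_mod_four (by omega) hcop]
      push_cast
      ring
    rw [show (0 : ℂ) = ((0 : ℤ) : ℂ) + ((0 : ℤ) : ℂ) * Complex.I by push_cast; ring]
    exact hasTraceAndMultiplicities_of_quadGauss hr hG (by omega) (by omega) (by omega) (by omega)
  · have hG : quadGauss r n = Real.sqrt n * (((0 : ℤ) : ℂ) + ((1 : ℤ) : ℂ) * Complex.I) := by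
      rw [quadGauss_odd (Nat.odd_iff.2 (by omega)) hcop, hJ,
        quadGauss_one_of_mod_four_eq_three (by omega)]
      push_cast
      ring
    rw [show (Complex.I : ℂ) = ((0 : ℤ) : ℂ) + ((1 : ℤ) : ℂ) * Complex.I by push_cast; ring]
    exact hasTraceAndMultiplicities_of_quadGauss hr hG (by omega) (by omega) (by omega) (by omega)
  · have hG : quadGauss r n = Real.sqrt n * (((0 : ℤ) : ℂ) + ((-1 : ℤ) : ℂ) * Complex.I) := by
      rw [quadGauss_odd (Nat.odd_iff.2 (by omega)) hcop, hJ,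
        quadGauss_one_of_mod_four_eq_three (by omega)]
      push_cast
      ring
    rw [show (-Complex.I : ℂ) = ((0 : ℤ) : ℂ) + ((-1 : ℤ) : ℂ) * Complex.I by push_cast; ring]
    exact hasTraceAndMultiplicities_of_quadGauss hr hG (by omega) (by omega) (by omega) (by omega)
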